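/- For permutations $\sigma$ of $[n]=\{1,\dots,n\}$ and $\tau$ of $[k]$, say that $\sigma$ contains $\tau$ if some subsequence $\sigma_{i_1}\cdots\sigma_{i_k}$ with $i_1<\cdots<i_k$ has the same relative order as $\tau$, and otherwise that $\sigma$ avoids $\tau$. Let $S_n(312,\tau)$ be the set of permutations of $[n]$ that avoid both $312$ and $\tau$, let $L_n(\sigma)$ be the length of a longest increasing subsequence of $\sigma$, and let $\mathbb E^{\tau}(L_n)$ be the expected value of $L_n(\sigma)$ for $\sigma$ uniformly distributed on $S_n(312,\tau)$. Let $U_j$ be the Chebyshev polynomial of the second kind, $U_j(\cos\theta)=\sin((j+1)\theta)/\sin\theta$. **Theorem.** Let $m\ge 4$ and $\hat{\mathbf m}=(m-1)\,m\,(m-2)(m-3)\cdots 2\,1$. Then, as $n\to\infty$, $$\mathbb E^{\hat{\mathbf m}}(L_n)\sim c_m\,n,\qquad c_m=\frac{U_2\!\left(\cos\frac{\pi}{m+1}\right)+\sum_{j=2}^{m-1}U_j^2\!\left(\cos\frac{\pi}{m+1}\right)} {2^{m+1}\cos^3\!\left(\frac{\pi}{m+1}\right)\,U_{m-1}\!\left(\cos\frac{\pi}{m+1}\right)\prod_{j=2}^{m-1}\left(\cos\frac{\pi}{m+1}-\cos\frac{j\pi}{m+1}\right)},$$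 that is, $\lim_{n\to\infty}\mathbb E^{\hat{\mathbf m}}(L_n)/(c_m n)=1$. -/

import Mathlib

open Filter Topology

/-- `σ` contains the pattern `τ`: some subsequence of `σ`, taken at increasing positions `f`,
has the same relative order as `τ`. A permutation `σ` of `[n]` is an element of
`Equiv.Perm (Fin n)`, with positions and values counted from `0`. -/
def ContainsPattern {n k : ℕ} (σ : Equiv.Perm (Fin n)) (τ : Equiv.Perm (Fin k)) : Prop :=
  ∃ f : Fin k ↪o Fin n, ∀ s t : Fin k, σ (f s) < σ (f t) ↔ τ s < τ t

/-- The pattern `312`. -/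
def pattern312 : Equiv.Perm (Fin 3) where
  toFun := ![2, 0, 1]
  invFun := ![1, 2, 0]
  left_inv := by decide
  right_inv := by decide

/-- The pattern `(m-1) m (m-2) (m-3) ⋯ 2 1`: the decreasing permutation `m (m-1) ⋯ 2 1`
with its first two entries exchanged. -/
def hatPattern (m : ℕ) (hm : 2 ≤ m) : Equiv.Perm (Fin m) :=
  (Equiv.swap ⟨0, by omega⟩ ⟨1, by omega⟩).trans Fin.revPerm

/-- The one-line notation of `hatPattern m`, with values counted from `1`. -/
theorem hatPattern_apply (m : ℕ) (hm : 2 ≤ m) (i : Fin m) :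
    (hatPattern m hm i : ℕ) + 1 =
      if (i : ℕ) = 0 then m - 1 else if (i : ℕ) = 1 then m else m - i := by
  rcases i with ⟨i, hi⟩
  simp only [hatPattern, Equiv.trans_apply, Equiv.swap_apply_def, Fin.revPerm_apply,
    Fin.val_rev, Fin.mk.injEq]
  split_ifs <;> simp <;> omega

open Classical in
/-- `S_n(312, τ)`: the permutations of length `n` that avoid both `312` and `τ`. -/
noncomputable def avoiders (n : ℕ) {k : ℕ} (τ : Equiv.Perm (Fin k)) :
    Finset (Equiv.Perm (Fin n)) :=
  {σ | ¬ ContainsPattern σ pattern312 ∧ ¬ ContainsPattern σ τ}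

open Classical in
/-- `L_n(σ)`: the largest size of a set of positions on which `σ` is increasing. -/
noncomputable def lisLength {n : ℕ} (σ : Equiv.Perm (Fin n)) : ℕ :=
  ({S : Finset (Fin n) | StrictMonoOn σ (S : Set (Fin n))} : Finset (Finset (Fin n))).sup
    Finset.card

/-- The expected value of `L_n` under the uniform distribution on `S_n(312, τ)`. -/
noncomputable def expectedLIS (n : ℕ) {k : ℕ} (τ : Equiv.Perm (Fin k)) : ℝ :=
  (∑ σ ∈ avoiders n τ, (lisLength σ : ℝ)) / ((avoiders n τ).card : ℝ)

/-- The value `U_j(x)` of the Chebyshev polynomial of the second kind at a real `x`. -/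
noncomputable def chebU (j : ℕ) (x : ℝ) : ℝ :=
  (Polynomial.Chebyshev.U ℝ (j : ℤ)).eval x

/-- The constant `c_m`, the growth rate of the expected value of `L_n`. -/
noncomputable def lisConst (m : ℕ) : ℝ :=
  (chebU 2 (Real.cos (Real.pi / (m + 1))) +
      ∑ j ∈ Finset.Icc 2 (m - 1), chebU j (Real.cos (Real.pi / (m + 1))) ^ 2) /
    (2 ^ (m + 1) * Real.cos (Real.pi / (m + 1)) ^ 3 *
      chebU (m - 1) (Real.cos (Real.pi / (m + 1))) *
      ∏ j ∈ Finset.Icc 2 (m - 1),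
        (Real.cos (Real.pi / (m + 1)) - Real.cos (j * Real.pi / (m + 1))))

/-! Cutting a nonempty 312-avoider just after its minimum writes it uniquely as `(π₁ ⊖ 1) ⊕ π₂`.
Since the pattern of length `m + 1` is the pattern of length `m` followed by a new minimum, avoiding
it means that `π₁` avoids the shorter pattern and `π₂` the same one (`permGlue_mem_avoiders`). The
longest increasing subsequence is additive over this decomposition, up to a correction when `π₁` is
empty (`lisLength_permGlue`).

Let `F_k` and `G_k` be the generating functions of the avoiders of the pattern of length `k + 2` and
of their total LIS length. Then `F_{k+1} = 1 + x F_k F_{k+1}` and `G_{k+1} = x (G_k + 1) F_{k+1}²`.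
Solving the first recursion gives `F_k = R_{k+1} / R_{k+2}` with `R_j(x) = x^{j/2} U_j(1/(2√x))`.

For `m = K + 3` put `c = cos(π/(m+1))` and `ρ = 1/(4c²)`. The known roots of `U_m` show that
`F_{K+1}` has a simple pole at `ρ` and no other pole in the closed disc of radius `ρ`, while `G_K`
still converges absolutely there. So `G_{K+1}` has a double pole, and with `A` the limit of `ρⁿ [xⁿ]
F_{K+1}`, the quotient of coefficients is asymptotic to `ρ (G_K(ρ) + 1) A n`. Evaluating `G_K(ρ)`
(`hasAbsSum_lisSeries`) and `A` gives `c_m`. Complex analysis is replaced by absolutely summable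
series: after rescaling by `ρ`, the pole sits at `1` and is removed by multiplying by `1 - X`. -/

/-! ### Direct sums and skew sums of permutations -/

theorem castAdd_lt_castAdd_iff {a : ℕ} (b : ℕ) {p q : Fin a} :
    Fin.castAdd b p < Fin.castAdd b q ↔ p < q :=
  Iff.rfl

/-- The direct sum `τ ⊕ π` of two permutations in one-line notation. -/
def permDirectSum {a b : ℕ} (τ : Equiv.Perm (Fin a)) (π : Equiv.Perm (Fin b)) :
    Equiv.Perm (Fin (a + b)) :=
  (finSumFinEquiv.symm.trans (Equiv.sumCongr τ π)).trans finSumFinEquiv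

@[simp]
theorem permDirectSum_castAdd {a b : ℕ} (τ : Equiv.Perm (Fin a)) (π : Equiv.Perm (Fin b))
    (p : Fin a) : permDirectSum τ π (Fin.castAdd b p) = Fin.castAdd b (τ p) := by
  simp [permDirectSum]

@[simp]
theorem permDirectSum_natAdd {a b : ℕ} (τ : Equiv.Perm (Fin a)) (π : Equiv.Perm (Fin b))
    (p : Fin b) : permDirectSum τ π (Fin.natAdd a p) = Fin.natAdd a (π p) := by
  simp [permDirectSum]

/-- The skew sum `π ⊖ 1`: the word of `π`, shifted up by one, followed by the minimum. -/
def permSkewOne {a : ℕ} (π : Equiv.Perm (Fin a)) : Equiv.Perm (Fin (a + 1)) :=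
  (finSuccEquivLast.trans π.optionCongr).trans (finSuccEquiv a).symm

@[simp]
theorem permSkewOne_castSucc {a : ℕ} (π : Equiv.Perm (Fin a)) (p : Fin a) :
    permSkewOne π p.castSucc = (π p).succ := by
  simp [permSkewOne]

@[simp]
theorem permSkewOne_last {a : ℕ} (π : Equiv.Perm (Fin a)) :
    permSkewOne π (Fin.last a) = 0 := by
  simp [permSkewOne]

theorem permDirectSum_injective {a b : ℕ} {τ τ' : Equiv.Perm (Fin a)} {π π' : Equiv.Perm (Fin b)}
    (h : permDirectSum τ π = permDirectSum τ' π') : τ = τ' ∧ π = π' := by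
  constructor
  · ext p
    simpa using congrArg Fin.val (DFunLike.congr_fun h (Fin.castAdd b p))
  · ext p
    simpa using congrArg Fin.val (DFunLike.congr_fun h (Fin.natAdd a p))

theorem permSkewOne_injective {a : ℕ} :
    Function.Injective (permSkewOne : Equiv.Perm (Fin a) → Equiv.Perm (Fin (a + 1))) := by
  intro π π' h
  ext p
  simpa using congrArg Fin.val (DFunLike.congr_fun h p.castSucc)

theorem exists_eq_permSkewOne {a : ℕ} (τ : Equiv.Perm (Fin (a + 1))) (h : τ (Fin.last a) = 0) :
    ∃ π : Equiv.Perm (Fin a), τ = permSkewOne π := by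
  set e : Equiv.Perm (Option (Fin a)) := (finSuccEquivLast.symm.trans τ).trans (finSuccEquiv a)
    with he
  have hn : e none = none := by simp [he, h]
  refine ⟨Equiv.removeNone e, ?_⟩
  have h1 := map_equiv_removeNone e
  rw [hn, Equiv.swap_self] at h1
  have h2 : (Equiv.removeNone e).optionCongr = e := by
    rw [h1]; ext; simp
  rw [permSkewOne, h2, he]
  ext p; simp

/-- By finiteness either half of the hypothesis implies the other. The disjunction is used so that
its negation supplies a bad entry on each side of the cut. -/
theorem exists_eq_permDirectSum {a b : ℕ} (σ : Equiv.Perm (Fin (a + b)))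
    (h : (∀ p : Fin a, ((σ (Fin.castAdd b p) : Fin (a + b)) : ℕ) < a) ∨
      ∀ q : Fin b, a ≤ ((σ (Fin.natAdd a q) : Fin (a + b)) : ℕ)) :
    ∃ τ π, σ = permDirectSum τ π := by
  set e : Equiv.Perm (Fin a ⊕ Fin b) := (finSumFinEquiv.trans σ).trans finSumFinEquiv.symm with he
  have key : Set.MapsTo e (Set.range Sum.inl) (Set.range Sum.inl) := by
    rcases h with h | h
    · rintro _ ⟨p, rfl⟩
      refine ⟨⟨_, h p⟩, ?_⟩
      rw [he]
      simp only [Equiv.trans_apply]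
      rw [Equiv.eq_symm_apply]
      ext; simp
    · rw [Equiv.Perm.perm_mapsTo_inl_iff_mapsTo_inr]
      rintro _ ⟨q, rfl⟩
      refine ⟨⟨(σ (Fin.natAdd a q) : ℕ) - a, by have := (σ (Fin.natAdd a q)).2; have := h q; omega⟩,
        ?_⟩
      rw [he]
      simp only [Equiv.trans_apply]
      rw [Equiv.eq_symm_apply]
      ext
      have := h q
      simp; omega
  obtain ⟨⟨τ, π⟩, h2⟩ := Equiv.Perm.mem_sumCongrHom_range_of_perm_mapsTo_inl key
  refine ⟨τ, π, ?_⟩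
  rw [Equiv.Perm.sumCongrHom_apply] at h2
  change Equiv.sumCongr τ π = e at h2
  rw [permDirectSum, h2, he]
  ext p; simp

/-! ### Pattern containment in sums -/

section Containment

theorem containsPattern_of_strictMono {n k : ℕ} {σ : Equiv.Perm (Fin n)} {P : Equiv.Perm (Fin k)}
    (f : Fin k → Fin n) (hmono : StrictMono f) (hf : ∀ s t, σ (f s) < σ (f t) ↔ P s < P t) :
    ContainsPattern σ P :=
  ⟨OrderEmbedding.ofStrictMono f hmono, hf⟩

variable {n N k : ℕ} {σ : Equiv.Perm (Fin N)} {π : Equiv.Perm (Fin n)} {P : Equiv.Perm (Fin k)}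

theorem ContainsPattern.of_embedding (g : Fin n ↪o Fin N)
    (hg : ∀ p q, σ (g p) < σ (g q) ↔ π p < π q) (h : ContainsPattern π P) :
    ContainsPattern σ P := by
  obtain ⟨f, hf⟩ := h
  exact ⟨f.trans g, fun s t => by simp [hg, hf]⟩

theorem ContainsPattern.of_mem_range (g : Fin n ↪o Fin N)
    (hg : ∀ p q, σ (g p) < σ (g q) ↔ π p < π q) (f : Fin k ↪o Fin N)
    (hf : ∀ s t, σ (f s) < σ (f t) ↔ P s < P t) (hr : ∀ s, f s ∈ Set.range g) :
    ContainsPattern π P := by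
  choose h hh using hr
  refine containsPattern_of_strictMono h (fun s t hst => ?_) fun s t => ?_
  · rw [← g.lt_iff_lt, hh, hh]
    exact f.strictMono hst
  · rw [← hg, hh, hh, hf]

end Containment

/-- An occurrence that starts in the left block and ends in the right one would have its last entry
above its first, against `hP`; hence it stays in one block. -/
theorem containsPattern_permDirectSum {a b k : ℕ} (τ : Equiv.Perm (Fin a))
    (π : Equiv.Perm (Fin b)) (P : Equiv.Perm (Fin (k + 1))) (hP : P (Fin.last k) < P 0) :
    ContainsPattern (permDirectSum τ π) P ↔ ContainsPattern τ P ∨ ContainsPattern π P := by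
  have hl : ∀ p q, permDirectSum τ π (Fin.castAddOrderEmb b p) <
      permDirectSum τ π (Fin.castAddOrderEmb b q) ↔ τ p < τ q := by
    simp [castAdd_lt_castAdd_iff]
  have hr : ∀ p q, permDirectSum τ π (Fin.natAddOrderEmb a p) <
      permDirectSum τ π (Fin.natAddOrderEmb a q) ↔ π p < π q := by simp
  constructor
  · rintro ⟨f, hf⟩
    by_cases h0 : a ≤ (f 0 : ℕ)
    · right
      refine .of_mem_range _ hr f hf fun s => ?_
      have h1 : f 0 ≤ f s := f.monotone (Fin.zero_le s)
      have h2 : a ≤ (f s : ℕ) := h0.trans h1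
      exact ⟨⟨(f s : ℕ) - a, by omega⟩, by ext; simp; omega⟩
    · left
      have hlast : (f (Fin.last k) : ℕ) < a := by
        by_contra hc
        have e1 : f 0 = Fin.castAdd b ⟨f 0, by omega⟩ := by ext; simp
        have e2 : f (Fin.last k) = Fin.natAdd a ⟨(f (Fin.last k) : ℕ) - a, by omega⟩ := by
          ext; simp; omega
        have h3 := (hf (Fin.last k) 0).2 hP
        rw [e1, e2, permDirectSum_castAdd, permDirectSum_natAdd, Fin.lt_def, Fin.val_castAdd,
          Fin.val_natAdd] at h3
        omega
      refine .of_mem_range _ hl f hf fun s => ?_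
      have h1 : f s ≤ f (Fin.last k) := f.monotone (Fin.le_last s)
      rw [Fin.le_def] at h1
      exact ⟨⟨f s, by omega⟩, by ext; simp⟩
  · rintro (h | h)
    · exact h.of_embedding _ hl
    · exact h.of_embedding _ hr

theorem permSkewOne_lt_iff {a : ℕ} (π : Equiv.Perm (Fin a)) (p q : Fin a) :
    permSkewOne π (Fin.castSuccOrderEmb p) < permSkewOne π (Fin.castSuccOrderEmb q) ↔
      π p < π q := by
  simp

/-- The appended minimum could only play the last letter of `P`, which is not the smallest letter of
`P`. -/
theorem containsPattern_permSkewOne_of_last {a k : ℕ} (π : Equiv.Perm (Fin a))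
    (P : Equiv.Perm (Fin (k + 1))) (s₀ : Fin (k + 1)) (hP : P s₀ < P (Fin.last k)) :
    ContainsPattern (permSkewOne π) P ↔ ContainsPattern π P := by
  refine ⟨?_, fun h => h.of_embedding _ (permSkewOne_lt_iff π)⟩
  rintro ⟨f, hf⟩
  have hne : f (Fin.last k) ≠ Fin.last a := by
    intro hc
    have h3 := (hf s₀ (Fin.last k)).2 hP
    rw [hc, permSkewOne_last] at h3
    exact absurd h3 (Fin.not_lt_zero _)
  refine .of_mem_range _ (permSkewOne_lt_iff π) f hf fun s => ?_
  have h1 : f s ≤ f (Fin.last k) := f.monotone (Fin.le_last s)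
  have h2 : f s ≠ Fin.last a := fun hc => hne (le_antisymm (Fin.le_last _) (hc ▸ h1))
  exact ⟨(f s).castPred h2, by simp⟩

theorem containsPattern_permSkewOne_permSkewOne {a k : ℕ} (π : Equiv.Perm (Fin a))
    (P : Equiv.Perm (Fin k)) :
    ContainsPattern (permSkewOne π) (permSkewOne P) ↔ ContainsPattern π P := by
  constructor
  · rintro ⟨f, hf⟩
    refine .of_mem_range _ (permSkewOne_lt_iff π) (Fin.castSuccOrderEmb.trans f) (fun s t => ?_)
      fun s => ?_
    · rw [RelEmbedding.trans_apply, RelEmbedding.trans_apply, hf, permSkewOne_lt_iff]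
    · have h1 : f s.castSucc < f (Fin.last k) := f.strictMono (Fin.castSucc_lt_last s)
      have h2 : f s.castSucc ≠ Fin.last a := (h1.trans_le (Fin.le_last _)).ne
      exact ⟨(f s.castSucc).castPred h2, by simp⟩
  · rintro ⟨f, hf⟩
    refine containsPattern_of_strictMono
      (fun s => Fin.lastCases (Fin.last a) (fun s => (f s).castSucc) s) ?_ ?_
    · intro s t hst
      induction t using Fin.lastCases with
      | last =>
        induction s using Fin.lastCases with
        | last => exact absurd hst (lt_irrefl _)
        | cast s => simp [Fin.castSucc_lt_last]
      | cast t =>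
        induction s using Fin.lastCases with
        | last => exact absurd hst (Fin.le_last _).not_gt
        | cast s => simpa using hst
    · intro s t
      induction t using Fin.lastCases with
      | last => simp
      | cast t =>
        induction s using Fin.lastCases with
        | last => simp
        | cast s => simp [hf]

theorem hatPattern_succ (m : ℕ) (hm : 2 ≤ m) :
    hatPattern (m + 1) (by omega) = permSkewOne (hatPattern m hm) := by
  ext p
  have h1 := hatPattern_apply (m + 1) (by omega) p
  induction p using Fin.lastCases with
  | last =>
    simp only [Fin.val_last, permSkewOne_last, Fin.val_zero] at h1 ⊢
    split_ifs at h1 <;> omega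
  | cast p =>
    have h2 := hatPattern_apply m hm p
    simp only [Fin.val_castSucc, permSkewOne_castSucc, Fin.val_succ] at h1 ⊢
    split_ifs at h1 h2 <;> omega

/-! ### Longest increasing subsequences of sums -/

section LIS

theorem card_le_lisLength {n : ℕ} {σ : Equiv.Perm (Fin n)} {S : Finset (Fin n)}
    (h : StrictMonoOn σ (S : Set (Fin n))) : S.card ≤ lisLength σ := by
  classical
  rw [lisLength]
  exact Finset.le_sup (f := Finset.card) (by simpa using h)

theorem lisLength_le {n N : ℕ} {σ : Equiv.Perm (Fin n)}
    (h : ∀ S : Finset (Fin n), StrictMonoOn σ (S : Set (Fin n)) → S.card ≤ N) :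
    lisLength σ ≤ N := by
  classical
  rw [lisLength, Finset.sup_le_iff]
  exact fun S hS => h S (by simpa using hS)

theorem exists_card_eq_lisLength {n : ℕ} (σ : Equiv.Perm (Fin n)) :
    ∃ S : Finset (Fin n), StrictMonoOn σ (S : Set (Fin n)) ∧ S.card = lisLength σ := by
  classical
  obtain ⟨S, hS, h⟩ := Finset.exists_mem_eq_sup
    ({S : Finset (Fin n) | StrictMonoOn σ (S : Set (Fin n))} : Finset (Finset (Fin n)))
    ⟨∅, by simp [StrictMonoOn]⟩ Finset.card
  exact ⟨S, by simpa using hS, by rw [lisLength, h]⟩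

theorem lisLength_eq_zero (σ : Equiv.Perm (Fin 0)) : lisLength σ = 0 :=
  Nat.le_zero.1 <| lisLength_le fun S _ => by simp [Finset.eq_empty_of_isEmpty S]

theorem one_le_lisLength {n : ℕ} (σ : Equiv.Perm (Fin (n + 1))) : 1 ≤ lisLength σ := by
  simpa using card_le_lisLength (σ := σ) (S := {0}) (by simp)

theorem lisLength_permDirectSum {a b : ℕ} (τ : Equiv.Perm (Fin a)) (π : Equiv.Perm (Fin b)) :
    lisLength (permDirectSum τ π) = lisLength τ + lisLength π := by
  classical
  apply le_antisymm
  · refine lisLength_le fun S hS => ?_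
    have h1 : S.card = ({p | Fin.castAdd b p ∈ S} : Finset (Fin a)).card +
        ({p | Fin.natAdd a p ∈ S} : Finset (Fin b)).card := by
      have : S = Finset.univ.filter (· ∈ S) := by ext; simp
      rw [this, Finset.card_filter, Fin.sum_univ_add, ← Finset.card_filter, ← Finset.card_filter]
      simp
    rw [h1]
    refine add_le_add (card_le_lisLength fun p hp q hq hpq => ?_)
      (card_le_lisLength fun p hp q hq hpq => ?_)
    · simpa [castAdd_lt_castAdd_iff] using hS (by simpa using hp) (by simpa using hq)
        (show Fin.castAdd b p < Fin.castAdd b q from hpq)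
    · simpa using hS (by simpa using hp) (by simpa using hq)
        (show Fin.natAdd a p < Fin.natAdd a q by simpa using hpq)
  · obtain ⟨A, hA, hA'⟩ := exists_card_eq_lisLength τ
    obtain ⟨B, hB, hB'⟩ := exists_card_eq_lisLength π
    rw [← hA', ← hB', ← Finset.card_disjSum, ← Finset.card_map finSumFinEquiv.toEmbedding]
    refine card_le_lisLength ?_
    intro x hx y hy hxy
    simp only [Finset.coe_map, Set.mem_image, Finset.mem_coe, Finset.mem_disjSum] at hx hy
    obtain ⟨_, ⟨p, hp, rfl⟩ | ⟨p, hp, rfl⟩, rfl⟩ := hx <;>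
    obtain ⟨_, ⟨q, hq, rfl⟩ | ⟨q, hq, rfl⟩, rfl⟩ := hy
    · simpa [castAdd_lt_castAdd_iff] using hA hp hq (by simpa [castAdd_lt_castAdd_iff] using hxy)
    · simp [Fin.lt_def]; omega
    · simp [Fin.lt_def] at hxy; omega
    · simpa using hB hp hq (by simpa using hxy)

theorem lisLength_permSkewOne {a : ℕ} (π : Equiv.Perm (Fin a)) :
    lisLength (permSkewOne π) = max 1 (lisLength π) := by
  classical
  apply le_antisymm
  · refine lisLength_le fun S hS => ?_
    by_cases hl : Fin.last a ∈ S
    · refine le_max_of_le_left (Finset.card_le_one.2 fun x hx y hy => ?_)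
      have key : ∀ z ∈ S, z = Fin.last a := by
        intro z hz
        by_contra hne
        have := hS hz hl (lt_of_le_of_ne (Fin.le_last z) hne)
        rw [permSkewOne_last] at this
        exact absurd this (Fin.not_lt_zero _)
      rw [key x hx, key y hy]
    · refine le_max_of_le_right ?_
      have h1 : S.card = ({p | Fin.castSucc p ∈ S} : Finset (Fin a)).card := by
        have : S = Finset.univ.filter (· ∈ S) := by ext; simp
        rw [this, Finset.card_filter, Fin.sum_univ_castSucc, ← Finset.card_filter]
        simp [hl]
      rw [h1]
      refine card_le_lisLength fun p hp q hq hpq => ?_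
      simpa using hS (by simpa using hp) (by simpa using hq)
        (show Fin.castSucc p < Fin.castSucc q by simpa using hpq)
  · refine max_le (one_le_lisLength _) ?_
    obtain ⟨A, hA, hA'⟩ := exists_card_eq_lisLength π
    rw [← hA', ← Finset.card_map Fin.castSuccEmb]
    refine card_le_lisLength ?_
    intro x hx y hy hxy
    simp only [Finset.coe_map, Set.mem_image, Finset.mem_coe] at hx hy
    obtain ⟨p, hp, rfl⟩ := hx
    obtain ⟨q, hq, rfl⟩ := hy
    simpa using hA hp hq (by simpa using hxy)

end LIS

/-! ### Decomposition of 312-avoiders at the minimum -/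

/-- The permutation `(π₁ ⊖ 1) ⊕ π₂`; every nonempty `312`-avoider has this form. -/
def permGlue {i j : ℕ} (π₁ : Equiv.Perm (Fin i)) (π₂ : Equiv.Perm (Fin j)) :
    Equiv.Perm (Fin (i + 1 + j)) :=
  permDirectSum (permSkewOne π₁) π₂

theorem permGlue_val_eq_zero_iff {i j : ℕ} (π₁ : Equiv.Perm (Fin i)) (π₂ : Equiv.Perm (Fin j))
    (p : Fin (i + 1 + j)) : (permGlue π₁ π₂ p : ℕ) = 0 ↔ (p : ℕ) = i := by
  induction p using Fin.addCases with
  | left p =>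
    induction p using Fin.lastCases with
    | last => simp [permGlue]
    | cast p => simp [permGlue, p.2.ne]
  | right p => simp [permGlue]; omega

/-- The position of the value `0` recovers `i`, hence the cut. -/
theorem permGlue_injective {i j i' j' : ℕ} {π₁ : Equiv.Perm (Fin i)} {π₂ : Equiv.Perm (Fin j)}
    {π₁' : Equiv.Perm (Fin i')} {π₂' : Equiv.Perm (Fin j')}
    (h : (⟨i + 1 + j, permGlue π₁ π₂⟩ : Σ n, Equiv.Perm (Fin n)) =
      ⟨i' + 1 + j', permGlue π₁' π₂'⟩) :
    i = i' ∧ j = j' ∧ HEq π₁ π₁' ∧ HEq π₂ π₂' := by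
  have key : ∀ x : Σ n, Equiv.Perm (Fin n), x = ⟨i' + 1 + j', permGlue π₁' π₂'⟩ →
      ∀ p : Fin x.1, (x.2 p : ℕ) = 0 ↔ (p : ℕ) = i' := by
    rintro _ rfl p
    exact permGlue_val_eq_zero_iff _ _ _
  have hi : i = i' := by
    have h1 := (key _ h ⟨i, by simp only; omega⟩).1 ((permGlue_val_eq_zero_iff _ _ _).2 rfl)
    exact h1
  have hj : j = j' := by
    have := congrArg Sigma.fst h
    simp only at this
    omega
  subst hi hj
  have h2 : permGlue π₁ π₂ = permGlue π₁' π₂' := by simpa using h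
  obtain ⟨h3, h4⟩ := permDirectSum_injective h2
  exact ⟨rfl, rfl, heq_of_eq (permSkewOne_injective h3), heq_of_eq h4⟩

theorem containsPattern_pattern312 {n : ℕ} {σ : Equiv.Perm (Fin n)} {p q r : Fin n} (hpq : p < q)
    (hqr : q < r) (h1 : σ q < σ r) (h2 : σ r < σ p) : ContainsPattern σ pattern312 := by
  refine containsPattern_of_strictMono ![p, q, r] ?_ ?_
  · intro s t hst
    fin_cases s <;> fin_cases t <;> simp_all [hpq.trans hqr]
  · intro s t
    have h3 := h1.trans h2
    fin_cases s <;> fin_cases t <;>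
      simp [pattern312, h1, h2, h3, h1.le, h2.le, h3.le]

theorem exists_eq_permGlue {N : ℕ} (σ : Equiv.Perm (Fin N)) (hN : 0 < N)
    (h : ¬ ContainsPattern σ pattern312) :
    ∃ (i j : ℕ) (π₁ : Equiv.Perm (Fin i)) (π₂ : Equiv.Perm (Fin j)),
      (⟨N, σ⟩ : Σ n, Equiv.Perm (Fin n)) = ⟨i + 1 + j, permGlue π₁ π₂⟩ := by
  obtain ⟨i, j, rfl, hi⟩ : ∃ i j, N = i + 1 + j ∧
      ∀ p : Fin N, (p : ℕ) = i → (σ p : ℕ) = 0 := by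
    refine ⟨σ.symm ⟨0, hN⟩, N - (σ.symm ⟨0, hN⟩ + 1), by omega, fun p hp => ?_⟩
    rw [Fin.ext hp]
    simp
  refine ⟨i, j, ?_⟩
  obtain ⟨τ, π₂, rfl⟩ : ∃ τ π, σ = permDirectSum τ π := by
    -- Otherwise a large entry before the minimum, the minimum itself and a small entry after it
    -- form a 312.
    apply exists_eq_permDirectSum
    by_contra! hc
    obtain ⟨⟨p, hp⟩, q, hq⟩ := hc
    have hk := hi (Fin.castAdd j (Fin.last i)) (by simp)
    refine h (containsPattern_pattern312 (p := Fin.castAdd j p) (q := Fin.castAdd j (Fin.last i))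
      (r := Fin.natAdd (i + 1) q) ?_ ?_ ?_ ?_)
    · rw [castAdd_lt_castAdd_iff]
      refine lt_of_le_of_ne (Fin.le_last p) ?_
      rintro rfl
      omega
    · rw [Fin.lt_def]; simp; omega
    · rw [Fin.lt_def, hk, Nat.pos_iff_ne_zero]
      intro h0
      have h1 := σ.injective (Fin.ext (h0.trans hk.symm))
      have := congrArg Fin.val h1
      simp at this
      omega
    · rw [Fin.lt_def]; omega
  have h0 : τ (Fin.last i) = 0 := by
    have := hi (Fin.castAdd j (Fin.last i)) (by simp)
    ext
    simpa using this
  obtain ⟨π₁, rfl⟩ := exists_eq_permSkewOne τ h0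
  exact ⟨π₁, π₂, rfl⟩

theorem mem_avoiders {n k : ℕ} {σ : Equiv.Perm (Fin n)} {τ : Equiv.Perm (Fin k)} :
    σ ∈ avoiders n τ ↔ ¬ ContainsPattern σ pattern312 ∧ ¬ ContainsPattern σ τ := by
  classical
  simp [avoiders]

theorem permGlue_mem_avoiders {i j m : ℕ} (hm : 2 ≤ m) (π₁ : Equiv.Perm (Fin i))
    (π₂ : Equiv.Perm (Fin j)) :
    permGlue π₁ π₂ ∈ avoiders (i + 1 + j) (hatPattern (m + 1) (by omega)) ↔
      π₁ ∈ avoiders i (hatPattern m hm) ∧ π₂ ∈ avoiders j (hatPattern (m + 1) (by omega)) := by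
  have h0 : hatPattern (m + 1) (by omega) (Fin.last m) < hatPattern (m + 1) (by omega) 0 := by
    have h1 := hatPattern_apply (m + 1) (by omega) (Fin.last m)
    have h2 := hatPattern_apply (m + 1) (by omega) 0
    simp only [Fin.val_last, Fin.val_zero] at h1 h2
    rw [Fin.lt_def]
    split_ifs at h1 h2 <;> omega
  rw [mem_avoiders, mem_avoiders, mem_avoiders, permGlue,
    containsPattern_permDirectSum _ _ pattern312 (by decide),
    containsPattern_permDirectSum _ _ _ h0,
    containsPattern_permSkewOne_of_last _ pattern312 1 (by decide), hatPattern_succ m hm,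
    containsPattern_permSkewOne_permSkewOne]
  tauto

/-- The weight lives on the sigma type so that the lengths `i + 1 + j` and `n + 1` need no cast. -/
theorem sum_avoiders_succ {M : Type*} [AddCommMonoid M] (n m : ℕ) (hm : 2 ≤ m)
    (Φ : (Σ n, Equiv.Perm (Fin n)) → M) :
    ∑ σ ∈ avoiders (n + 1) (hatPattern (m + 1) (by omega)), Φ ⟨n + 1, σ⟩ =
      ∑ p ∈ Finset.HasAntidiagonal.antidiagonal n, ∑ π₁ ∈ avoiders p.1 (hatPattern m hm),
        ∑ π₂ ∈ avoiders p.2 (hatPattern (m + 1) (by omega)),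
          Φ ⟨p.1 + 1 + p.2, permGlue π₁ π₂⟩ := by
  classical
  simp_rw [← Finset.sum_product']
  rw [Finset.sum_sigma']
  symm
  refine Eq.trans ?_ (Finset.sum_map _ (Function.Embedding.sigmaMk (β := fun n => Equiv.Perm (Fin n)) (n + 1)) Φ)
  refine Finset.sum_bij (fun x _ => ⟨x.1.1 + 1 + x.1.2, permGlue x.2.1 x.2.2⟩) ?_ ?_ ?_ ?_
  · rintro ⟨⟨i, j⟩, π₁, π₂⟩ hx
    simp only [Finset.mem_sigma, Finset.HasAntidiagonal.mem_antidiagonal, Finset.mem_product] at hx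
    obtain ⟨hij, h⟩ := hx
    have h3 := (permGlue_mem_avoiders hm π₁ π₂).2 h
    have h4 : i + 1 + j = n + 1 := by omega
    simp only [Finset.mem_map, Function.Embedding.sigmaMk_apply]
    revert h3
    generalize permGlue π₁ π₂ = σ
    revert σ
    rw [h4]
    exact fun σ hσ => ⟨σ, hσ, rfl⟩
  · rintro ⟨⟨i, j⟩, π₁, π₂⟩ _ ⟨⟨i', j'⟩, π₁', π₂'⟩ _ h
    obtain ⟨rfl, rfl, h1, h2⟩ := permGlue_injective h
    obtain rfl := eq_of_heq h1
    obtain rfl := eq_of_heq h2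
    rfl
  · intro y hy
    simp only [Finset.mem_map, Function.Embedding.sigmaMk_apply] at hy
    obtain ⟨σ, hσ, rfl⟩ := hy
    obtain ⟨i, j, π₁, π₂, h⟩ := exists_eq_permGlue σ (Nat.succ_pos n) (mem_avoiders.1 hσ).1
    have key : ∀ x : Σ n, Equiv.Perm (Fin n), x = ⟨i + 1 + j, permGlue π₁ π₂⟩ →
        x.2 ∈ avoiders x.1 (hatPattern (m + 1) (by omega)) →
        permGlue π₁ π₂ ∈ avoiders (i + 1 + j) (hatPattern (m + 1) (by omega)) := by
      rintro _ rfl h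
      exact h
    have h1 := (permGlue_mem_avoiders hm π₁ π₂).1 (key _ h hσ)
    have h2 := congrArg Sigma.fst h
    simp only at h2
    exact ⟨⟨(i, j), π₁, π₂⟩, by simp [h1]; omega, h.symm⟩
  · intro _ _
    rfl

theorem lisLength_permGlue {i j : ℕ} (π₁ : Equiv.Perm (Fin i)) (π₂ : Equiv.Perm (Fin j)) :
    lisLength (permGlue π₁ π₂) = lisLength π₁ + (if i = 0 then 1 else 0) + lisLength π₂ := by
  rw [permGlue, lisLength_permDirectSum, lisLength_permSkewOne]
  cases i with
  | zero => simp [lisLength_eq_zero π₁]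
  | succ i => simp [one_le_lisLength π₁]

theorem avoiders_hatPattern_two (n : ℕ) : avoiders n (hatPattern 2 le_rfl) = {Fin.revPerm} := by
  have h2 : ∀ {σ : Equiv.Perm (Fin n)} {p q : Fin n}, p < q → σ p < σ q →
      ContainsPattern σ (hatPattern 2 le_rfl) := by
    intro σ p q hpq h
    refine containsPattern_of_strictMono ![p, q] ?_ ?_
    · intro s t hst
      fin_cases s <;> fin_cases t <;> simp_all
    · have e : hatPattern 2 le_rfl 0 < hatPattern 2 le_rfl 1 := by decide
      intro s t
      fin_cases s <;> fin_cases t <;> simp [h, e, h.not_gt, e.not_gt]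
  ext σ
  rw [mem_avoiders, Finset.mem_singleton]
  constructor
  · rintro ⟨-, h⟩
    have hmono : StrictMono (fun p => (σ p).rev) := by
      intro p q hpq
      rw [Fin.rev_lt_rev]
      refine lt_of_le_of_ne (not_lt.1 fun hc => h (h2 hpq hc)) fun hc => ?_
      exact hpq.ne (σ.injective hc.symm)
    have h3 := hmono.range_inj (g := (id : Fin n → Fin n)) strictMono_id |>.1 <| by
      rw [Set.range_id]
      exact (Fin.rev_surjective.comp σ.surjective).range_eq
    ext p
    have h4 := congrFun h3 p
    simp only [id] at h4
    rw [Fin.revPerm_apply, ← h4, Fin.rev_rev]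
    simp [h4]
  · rintro rfl
    constructor
    · rintro ⟨f, hf⟩
      have h3 := (hf 1 2).2 (by decide)
      simp at h3
    · rintro ⟨f, hf⟩
      have h3 := (hf 0 1).2 (by decide)
      simp at h3

theorem lisLength_revPerm (n : ℕ) :
    lisLength (Fin.revPerm : Equiv.Perm (Fin (n + 1))) = 1 := by
  refine le_antisymm (lisLength_le fun S hS => Finset.card_le_one.2 fun x hx y hy => ?_)
    (one_le_lisLength _)
  by_contra hne
  rcases lt_or_gt_of_ne hne with h | h
  · exact lt_asymm h (by simpa using hS hx hy h)
  · exact lt_asymm h (by simpa using hS hy hx h)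

/-! ### Generating functions and their recursions -/

/-- The generating function of the numbers of permutations avoiding `312` and
`hatPattern (k + 2)`. -/
noncomputable def avoidersSeries (k : ℕ) : PowerSeries ℝ :=
  PowerSeries.mk fun n => ((avoiders n (hatPattern (k + 2) (by omega))).card : ℝ)

/-- The generating function of the total length of longest increasing subsequences over the
permutations avoiding `312` and `hatPattern (k + 2)`. -/
noncomputable def lisSeries (k : ℕ) : PowerSeries ℝ :=
  PowerSeries.mk fun n => ∑ σ ∈ avoiders n (hatPattern (k + 2) (by omega)), (lisLength σ : ℝ)

theorem avoiders_zero (k : ℕ) (hk : 2 ≤ k) : avoiders 0 (hatPattern k hk) = Finset.univ := by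
  ext σ
  simp only [mem_avoiders, Finset.mem_univ, iff_true]
  constructor
  · rintro ⟨f, -⟩
    exact (f 0).elim0
  · rintro ⟨f, -⟩
    exact (f ⟨0, by omega⟩).elim0

open PowerSeries in
theorem avoidersSeries_zero_mul : avoidersSeries 0 * (1 - X) = 1 := by
  have : avoidersSeries 0 = mk 1 := by
    ext n
    simp [avoidersSeries, avoiders_hatPattern_two]
  rw [this, mk_one_mul_one_sub_eq_one]

open PowerSeries in
theorem lisSeries_zero_mul : lisSeries 0 * (1 - X) = X := by
  have : lisSeries 0 = X * avoidersSeries 0 := by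
    ext n
    cases n with
    | zero => simp [lisSeries, avoiders_zero, lisLength_eq_zero]
    | succ n =>
      simp [lisSeries, avoidersSeries, avoiders_hatPattern_two, coeff_succ_X_mul,
        lisLength_revPerm]
  rw [this, mul_assoc, avoidersSeries_zero_mul, mul_one]

open PowerSeries in
theorem avoidersSeries_succ (k : ℕ) :
    avoidersSeries (k + 1) = 1 + X * (avoidersSeries k * avoidersSeries (k + 1)) := by
  ext n
  cases n with
  | zero => simp [avoidersSeries, avoiders_zero]
  | succ n =>
    rw [map_add, coeff_succ_X_mul, coeff_mul]
    simp only [avoidersSeries, coeff_mk, coeff_one]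
    have h := sum_avoiders_succ n (k + 2) (by omega) fun _ => (1 : ℝ)
    simpa using h

open PowerSeries in
theorem lisSeries_succ (k : ℕ) :
    lisSeries (k + 1) = X * ((lisSeries k + 1) * avoidersSeries (k + 1) +
      avoidersSeries k * lisSeries (k + 1)) := by
  ext n
  cases n with
  | zero => simp [lisSeries, avoiders_zero, lisLength_eq_zero]
  | succ n =>
    rw [coeff_succ_X_mul, map_add, coeff_mul, coeff_mul, ← Finset.sum_add_distrib]
    simp only [lisSeries, avoidersSeries, coeff_mk, map_add, coeff_one]
    have h := sum_avoiders_succ n (k + 2) (by omega) fun x => (lisLength x.2 : ℝ)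
    simp only [lisLength_permGlue] at h
    refine h.trans (Finset.sum_congr rfl fun p _ => ?_)
    -- There is exactly one avoider of length `0`, so the correction for empty `π₁` contributes the
    -- constant series `1`.
    have h0 : ((avoiders p.1 (hatPattern (k + 2) (by omega))).card : ℝ) *
        (if p.1 = 0 then 1 else 0) = if p.1 = 0 then 1 else 0 := by
      rcases p with ⟨i, j⟩
      cases i with
      | zero => simp [avoiders_zero]
      | succ i => simp
    rw [← h0]
    push_cast
    simp only [Finset.sum_add_distrib, Finset.sum_const, nsmul_eq_mul, Finset.sum_mul,
      Finset.mul_sum, add_mul]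
    simp only [mul_comm, mul_left_comm, mul_assoc]

theorem coeff_avoidersSeries (k n : ℕ) : PowerSeries.coeff n (avoidersSeries k) =
    ((avoiders n (hatPattern (k + 2) (by omega))).card : ℝ) := by
  simp [avoidersSeries]

theorem coeff_lisSeries (k n : ℕ) : PowerSeries.coeff n (lisSeries k) =
    ∑ σ ∈ avoiders n (hatPattern (k + 2) (by omega)), (lisLength σ : ℝ) := by
  simp [lisSeries]

/-! ### Absolutely summable power series and coefficient asymptotics -/

/-- The coefficients of the power series `f` are absolutely summable with sum `s`. -/
def HasAbsSum (f : PowerSeries ℝ) (s : ℝ) : Prop :=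
  (Summable fun n => ‖PowerSeries.coeff n f‖) ∧ ∑' n, PowerSeries.coeff n f = s

namespace HasAbsSum

open PowerSeries

variable {f g : PowerSeries ℝ} {s t : ℝ}

theorem unique (hf : HasAbsSum f s) (hf' : HasAbsSum f t) : s = t :=
  hf.2.symm.trans hf'.2

theorem hasSum (hf : HasAbsSum f s) : HasSum (fun n => coeff n f) s :=
  hf.2 ▸ hf.1.of_norm.hasSum

theorem add (hf : HasAbsSum f s) (hg : HasAbsSum g t) : HasAbsSum (f + g) (s + t) := by
  have h : Summable fun n => ‖coeff n f‖ + ‖coeff n g‖ := Summable.add hf.1 hg.1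
  refine ⟨Summable.of_nonneg_of_le (fun _ => norm_nonneg _) (fun n => ?_) h, ?_⟩
  · rw [map_add]
    exact norm_add_le _ _
  · simp only [map_add]
    exact (hf.hasSum.add hg.hasSum).tsum_eq

theorem mul (hf : HasAbsSum f s) (hg : HasAbsSum g t) : HasAbsSum (f * g) (s * t) := by
  refine ⟨?_, ?_⟩
  · simp only [coeff_mul]
    exact summable_norm_sum_mul_antidiagonal_of_summable_norm (f := fun n => coeff n f)
      (g := fun n => coeff n g) hf.1 hg.1
  · simp only [coeff_mul]
    rw [← tsum_mul_tsum_eq_tsum_sum_antidiagonal_of_summable_norm (f := fun n => coeff n f)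
      (g := fun n => coeff n g) hf.1 hg.1, hf.2, hg.2]

theorem coe (p : Polynomial ℝ) : HasAbsSum (p : PowerSeries ℝ) (p.eval 1) := by
  have h0 : ∀ n ∉ p.support, p.coeff n = 0 := fun n hn => by simpa using hn
  refine ⟨summable_of_ne_finset_zero (s := p.support) fun n hn => ?_, ?_⟩
  · simp [h0 n hn]
  · simp only [Polynomial.coeff_coe]
    rw [tsum_eq_sum (s := p.support) fun n hn => h0 n hn, Polynomial.eval_eq_sum]
    simp [Polynomial.sum]

protected theorem one : HasAbsSum 1 1 := by
  have h := HasAbsSum.coe (1 : Polynomial ℝ)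
  rw [Polynomial.coe_one, Polynomial.eval_one] at h
  exact h

theorem C_mul_X (r : ℝ) : HasAbsSum (C r * X) r := by
  have h := HasAbsSum.coe (Polynomial.C r * Polynomial.X)
  rw [Polynomial.coe_mul, Polynomial.coe_C, Polynomial.coe_X, Polynomial.eval_mul,
    Polynomial.eval_C, Polynomial.eval_X, mul_one] at h
  exact h

theorem geom {r : ℝ} (hr : |r| < 1) : HasAbsSum (mk fun n => r ^ n) (1 - r)⁻¹ := by
  refine ⟨?_, ?_⟩
  · simpa using summable_geometric_of_lt_one (abs_nonneg r) hr
  · simpa using tsum_geometric_of_abs_lt_one hr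

theorem prod {ι : Type*} (u : Finset ι) {F : ι → PowerSeries ℝ} {S : ι → ℝ}
    (h : ∀ i ∈ u, HasAbsSum (F i) (S i)) : HasAbsSum (∏ i ∈ u, F i) (∏ i ∈ u, S i) := by
  classical
  induction u using Finset.induction_on with
  | empty => simpa using HasAbsSum.one
  | insert a u ha ih =>
    rw [Finset.prod_insert ha, Finset.prod_insert ha]
    exact (h a (Finset.mem_insert_self _ _)).mul
      (ih fun i hi => h i (Finset.mem_insert_of_mem hi))

end HasAbsSum

theorem geom_mul_one_sub (r : ℝ) :
    (PowerSeries.mk fun n => r ^ n) * (1 - PowerSeries.C r * PowerSeries.X) = 1 := by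
  ext n
  rw [mul_sub, mul_one, map_sub, mul_left_comm, PowerSeries.coeff_C_mul]
  cases n with
  | zero => simp
  | succ n => simp [PowerSeries.coeff_succ_mul_X, PowerSeries.coeff_one, pow_succ']

theorem sum_range_sum_antidiagonal_le {a b : ℕ → ℝ} (ha : ∀ n, 0 ≤ a n) (hb : ∀ n, 0 ≤ b n)
    (N : ℕ) :
    ∑ n ∈ Finset.range N, ∑ p ∈ Finset.HasAntidiagonal.antidiagonal n, a p.1 * b p.2 ≤
      (∑ n ∈ Finset.range N, a n) * ∑ n ∈ Finset.range N, b n := by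
  classical
  rw [Finset.sum_mul_sum, ← Finset.sum_product', ← Finset.sum_biUnion]
  · refine Finset.sum_le_sum_of_subset_of_nonneg ?_ fun p _ _ => mul_nonneg (ha _) (hb _)
    intro p hp
    simp only [Finset.mem_biUnion, Finset.mem_range,
      Finset.HasAntidiagonal.mem_antidiagonal] at hp
    obtain ⟨n, hn, h⟩ := hp
    simp only [Finset.mem_product, Finset.mem_range]
    omega
  · intro i _ j _ hij
    rw [Function.onFun, Finset.disjoint_left]
    intro p hp hq
    rw [Finset.HasAntidiagonal.mem_antidiagonal] at hp hq
    exact hij (hp.symm.trans hq)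

open PowerSeries in
-- By nonnegativity the partial sums of `g` satisfy `T_{N+1} ≤ 1 + r s T_N`, so they never pass the
-- fixed point `(1 - r s)⁻¹`. Once `g` is summable, the equation itself determines its sum.
theorem HasAbsSum.of_eq_one_add {f g : PowerSeries ℝ} {r s : ℝ} (hf : HasAbsSum f s)
    (hf0 : ∀ n, 0 ≤ coeff n f) (hg0 : ∀ n, 0 ≤ coeff n g) (hr : 0 ≤ r) (hrs : r * s < 1)
    (h : g = 1 + C r * X * (f * g)) : HasAbsSum g (1 - r * s)⁻¹ := by
  have hpos : 0 < 1 - r * s := by linarith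
  have hzero : coeff 0 g = 1 := by
    rw [h]
    simp
  have hsucc : ∀ n, coeff (n + 1) g = r * coeff n (f * g) := by
    intro n
    conv_lhs => rw [h]
    rw [map_add, mul_assoc, coeff_C_mul, coeff_succ_X_mul, coeff_one]
    simp
  have hbound : ∀ N, ∑ n ∈ Finset.range N, coeff n g ≤ (1 - r * s)⁻¹ := by
    intro N
    induction N with
    | zero => simpa using hpos.le
    | succ N ih =>
      rw [Finset.sum_range_succ']
      simp only [hsucc, hzero, coeff_mul, ← Finset.mul_sum]
      have h1 := sum_range_sum_antidiagonal_le hf0 hg0 N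
      have h2 : ∑ n ∈ Finset.range N, coeff n f ≤ s :=
        sum_le_hasSum _ (fun n _ => hf0 n) hf.hasSum
      have h3 : 0 ≤ ∑ n ∈ Finset.range N, coeff n g := Finset.sum_nonneg fun n _ => hg0 n
      have h4 : 0 ≤ s := hf.hasSum.nonneg hf0
      have h5 := h1.trans ((mul_le_mul_of_nonneg_right h2 h3).trans
        (mul_le_mul_of_nonneg_left ih h4))
      calc _ ≤ r * (s * (1 - r * s)⁻¹) + 1 := by gcongr
        _ = _ := by field_simp; ring
  have hsum : Summable fun n => ‖coeff n g‖ := by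
    simp only [Real.norm_eq_abs, abs_of_nonneg (hg0 _)]
    exact summable_of_sum_range_le hg0 hbound
  have hg : HasAbsSum g (∑' n, coeff n g) := ⟨hsum, rfl⟩
  have h6 := HasAbsSum.one.add ((HasAbsSum.C_mul_X r).mul (hf.mul hg))
  rw [← h] at h6
  refine ⟨hsum, ?_⟩
  have h7 := hg.unique h6
  refine eq_inv_of_mul_eq_one_left ?_
  linear_combination h7

open PowerSeries in
theorem tendsto_coeff_of_mul_one_sub {f g : PowerSeries ℝ} {s : ℝ} (hg : HasAbsSum g s)
    (h : f * (1 - X) = g) : Tendsto (fun n => coeff n f) atTop (𝓝 s) := by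
  have h1 : ∀ n, coeff n f = ∑ i ∈ Finset.range (n + 1), coeff i g := by
    intro n
    induction n with
    | zero => simp [← h]
    | succ n ih =>
      rw [Finset.sum_range_succ, ← ih, ← h, mul_sub, mul_one, map_sub, coeff_succ_mul_X]
      ring
  simp only [h1]
  exact (tendsto_add_atTop_iff_nat 1).2 hg.hasSum.tendsto_sum_nat

open PowerSeries in
-- Dividing by `1 - X` once gives coefficients tending to `s`; dividing again gives their partial
-- sums, to which Cesàro averaging applies.
theorem tendsto_coeff_div_of_mul_one_sub_sq {f g : PowerSeries ℝ} {s : ℝ} (hg : HasAbsSum g s)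
    (h : f * (1 - X) ^ 2 = g) : Tendsto (fun n : ℕ => coeff n f / n) atTop (𝓝 s) := by
  have h0 := tendsto_coeff_of_mul_one_sub (f := f * (1 - X)) hg (by rw [← h]; ring)
  set v : ℕ → ℝ := fun n => coeff n (f * (1 - X)) with hv
  have h1 : ∀ n, coeff n f = ∑ i ∈ Finset.range n, v i + v n := by
    intro n
    rw [← Finset.sum_range_succ]
    induction n with
    | zero => simp [hv]
    | succ n ih =>
      rw [Finset.sum_range_succ, ← ih, hv]
      simp only [mul_sub, mul_one, map_sub, coeff_succ_mul_X]
      ring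
  have h2 := h0.cesaro
  have h3 := h0.div_atTop tendsto_natCast_atTop_atTop
  have h4 := h2.add h3
  rw [add_zero] at h4
  refine h4.congr fun n => ?_
  rw [h1]
  ring

open PowerSeries in
theorem rescale_coe_polynomial (r : ℝ) (p : Polynomial ℝ) :
    rescale r (p : PowerSeries ℝ) = (p.comp (Polynomial.C r * Polynomial.X) : Polynomial ℝ) := by
  ext n
  rw [coeff_rescale, Polynomial.coeff_coe, Polynomial.coeff_coe,
    Polynomial.comp_C_mul_X_coeff, mul_comm]

/-- If `D(t²)` factors over the reals with simple roots `±1` and all other roots outside the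
unit interval, then `D = (1 - X) * Q` with `1 / Q` absolutely summable. -/
theorem exists_absSum_inverse {ι : Type*} (u : Finset ι) (r : ι → ℝ) (hr : ∀ i ∈ u, |r i| < 1)
    (D : Polynomial ℝ)
    (hD : ∀ t : ℝ, t ≠ 0 → D.eval (t ^ 2) = (1 - t) * (1 + t) * ∏ i ∈ u, (1 - r i * t)) :
    ∃ S : PowerSeries ℝ, HasAbsSum S (∏ i ∈ u, (1 - r i))⁻¹ ∧
      S * (D : PowerSeries ℝ) = 1 - PowerSeries.X := by
  have hroot : D.IsRoot 1 := by
    have := hD 1 one_ne_zero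
    simpa using this
  obtain ⟨Q', hQ'⟩ := Polynomial.dvd_iff_isRoot.2 hroot
  obtain ⟨Q, hQ⟩ : ∃ Q, D = (1 - Polynomial.X) * Q := ⟨-Q', by rw [hQ']; simp; ring⟩
  have hcomp : Q.comp (Polynomial.X ^ 2) =
      ∏ i ∈ u, (1 - Polynomial.C (r i) * Polynomial.X) := by
    -- This factor covers the excluded point `t = 0` and the points `t = ±1`, where `1 - t²` cannot
    -- be cancelled.
    have hne : (Polynomial.X * (1 - Polynomial.X ^ 2) : Polynomial ℝ) ≠ 0 := by
      intro h
      have := congrArg (Polynomial.eval 2) h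
      norm_num at this
    refine mul_left_cancel₀ hne (Polynomial.funext fun t => ?_)
    rcases eq_or_ne t 0 with rfl | ht
    · simp
    · have h1 := hD t ht
      rw [hQ] at h1
      simp only [Polynomial.eval_mul, Polynomial.eval_sub, Polynomial.eval_one, Polynomial.eval_X,
        Polynomial.eval_pow, Polynomial.eval_comp, Polynomial.eval_prod, Polynomial.eval_C] at h1 ⊢
      rw [mul_assoc, h1]
      ring
  have hev : ∀ t : ℝ, Q.eval (t ^ 2) = ∏ i ∈ u, (1 - r i * t) := by
    intro t
    have := congrArg (Polynomial.eval t) hcomp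
    simpa [Polynomial.eval_prod] using this
  -- Multiply the factorizations of `Q(t²)` at `t` and `-t`. This avoids pairing the `r i` with
  -- their negatives.
  have hsq : Q ^ 2 = ∏ i ∈ u, (1 - Polynomial.C (r i ^ 2) * Polynomial.X) := by
    refine Polynomial.eq_of_infinite_eval_eq _ _ ((Set.Ici_infinite (0 : ℝ)).mono fun x hx => ?_)
    have hx' : (0 : ℝ) ≤ x := hx
    have h1 := hev √x
    have h2 := hev (-√x)
    rw [neg_sq, Real.sq_sqrt hx'] at h2
    rw [Real.sq_sqrt hx'] at h1
    simp only [Set.mem_ofPred_eq, Polynomial.eval_pow, Polynomial.eval_prod, Polynomial.eval_sub,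
      Polynomial.eval_one, Polynomial.eval_mul, Polynomial.eval_C, Polynomial.eval_X]
    rw [sq]
    nth_rewrite 1 [h1]
    rw [h2, ← Finset.prod_mul_distrib]
    refine Finset.prod_congr rfl fun i _ => ?_
    linear_combination (-(r i) ^ 2) * Real.sq_sqrt hx'
  have hr2 : ∀ i ∈ u, |r i ^ 2| < 1 := fun i hi => by
    rw [abs_pow]
    exact pow_lt_one₀ (abs_nonneg _) (hr i hi) two_ne_zero
  have hgeom := HasAbsSum.prod u fun i hi => HasAbsSum.geom (hr2 i hi)
  have hval : Q.eval 1 = ∏ i ∈ u, (1 - r i) := by simpa using hev 1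
  have hne : Q.eval 1 ≠ 0 := by
    rw [hval]
    exact Finset.prod_ne_zero_iff.2 fun i hi => by linarith [(abs_lt.1 (hr i hi)).2]
  -- The series is `1 / Q` written as `Q / Q²`, with `1 / Q²` a product of geometric series.
  refine ⟨(Q : PowerSeries ℝ) * ∏ i ∈ u, PowerSeries.mk fun n => (r i ^ 2) ^ n, ?_, ?_⟩
  · have h1 := (HasAbsSum.coe Q).mul hgeom
    have h2 : ∏ i ∈ u, (1 - r i ^ 2)⁻¹ = (Q.eval 1 ^ 2)⁻¹ := by
      rw [← Polynomial.eval_pow, hsq, Finset.prod_inv_distrib]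
      simp [Polynomial.eval_prod]
    rw [h2] at h1
    rw [← hval]
    convert h1 using 1
    field_simp
  · have h1 : (Q : PowerSeries ℝ) ^ 2 =
        ∏ i ∈ u, (1 - PowerSeries.C (r i ^ 2) * PowerSeries.X) := by
      have := congrArg (Polynomial.coeToPowerSeries.ringHom (R := ℝ)) hsq
      simpa [map_prod] using this
    have h2 : (∏ i ∈ u, PowerSeries.mk fun n => (r i ^ 2) ^ n) * (Q : PowerSeries ℝ) ^ 2 = 1 := by
      rw [h1, ← Finset.prod_mul_distrib]
      exact Finset.prod_eq_one fun i _ => geom_mul_one_sub _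
    rw [hQ]
    push_cast
    linear_combination (1 - PowerSeries.X) * h2

/-! ### Chebyshev polynomials and the closed form of the counting series -/

theorem chebU_zero (x : ℝ) : chebU 0 x = 1 := by
  simp [chebU]

theorem chebU_one (x : ℝ) : chebU 1 x = 2 * x := by
  simp [chebU]

theorem chebU_add_two (j : ℕ) (x : ℝ) :
    chebU (j + 2) x = 2 * x * chebU (j + 1) x - chebU j x := by
  simp [chebU]

theorem chebU_eq_prod (m : ℕ) (x : ℝ) :
    chebU m x =
      2 ^ m * ∏ k ∈ Finset.range m, (x - Real.cos ((k + 1) * Real.pi / (m + 1))) := by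
  have hU := Polynomial.Chebyshev.roots_U_real m
  have hinj := (Finset.range m).nodup_map_iff_injOn.mp
    (Polynomial.Chebyshev.roots_U_real_nodup m)
  have hcard : Multiset.card (Polynomial.Chebyshev.U ℝ (m : ℤ)).roots =
      (Polynomial.Chebyshev.U ℝ (m : ℤ)).natDegree := by
    rw [hU, Finset.card_val, Finset.card_image_of_injOn hinj, Finset.card_range,
      Polynomial.Chebyshev.natDegree_U_natCast]
  have h := Polynomial.C_leadingCoeff_mul_prod_multiset_X_sub_C hcard
  have h1 := congrArg (Polynomial.eval x) h
  rw [chebU, ← h1, hU, Polynomial.Chebyshev.leadingCoeff_U_natCast]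
  change Polynomial.eval x (_ * ∏ a ∈ Finset.image _ _, _) = _
  rw [Finset.prod_image hinj]
  simp [Polynomial.eval_prod]

theorem chebU_cos_mul_sin (j : ℕ) (θ : ℝ) :
    chebU j (Real.cos θ) * Real.sin θ = Real.sin ((j + 1) * θ) := by
  simpa only [chebU, Int.cast_natCast] using Polynomial.Chebyshev.U_real_cos θ (j : ℤ)

theorem chebU_cos_pos {m j : ℕ} (hj : j < m) :
    0 < chebU j (Real.cos (Real.pi / (m + 1))) := by
  have hπ := Real.pi_pos
  have hm : (0 : ℝ) < m + 1 := by positivity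
  have hj' : (j : ℝ) + 1 ≤ m := by exact_mod_cast hj
  have key : ∀ k : ℝ, 0 < k → k < m + 1 → 0 < Real.sin (k * (Real.pi / (m + 1))) := by
    intro k hk hk'
    refine Real.sin_pos_of_pos_of_lt_pi (by positivity) ?_
    rw [← mul_div_assoc, div_lt_iff₀ hm]
    nlinarith
  have h1 := key (j + 1) (by positivity) (by linarith)
  have h2 : 0 < Real.sin (Real.pi / (m + 1)) := by
    simpa using key 1 one_pos (by have : (0 : ℝ) ≤ j := by positivity
                                  linarith)
  rw [← chebU_cos_mul_sin] at h1
  exact pos_of_mul_pos_left h1 h2.le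

/-- The polynomials `x ^ (j / 2) * U_j (1 / (2 √x))`. -/
noncomputable def revChebU : ℕ → Polynomial ℝ
  | 0 => 1
  | 1 => 1
  | (j + 2) => revChebU (j + 1) - Polynomial.X * revChebU j

theorem revChebU_add_two (j : ℕ) :
    revChebU (j + 2) = revChebU (j + 1) - Polynomial.X * revChebU j := by
  rw [revChebU]

theorem eval_revChebU (x : ℝ) (hx : x ≠ 0) : ∀ j : ℕ,
    (revChebU j).eval ((2 * x)⁻¹ ^ 2) = (2 * x)⁻¹ ^ j * chebU j x
  | 0 => by simp [revChebU, chebU_zero]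
  | 1 => by
    rw [revChebU, chebU_one, Polynomial.eval_one, pow_one, inv_mul_cancel₀ (by simpa using hx)]
  | (j + 2) => by
    rw [revChebU_add_two, Polynomial.eval_sub, Polynomial.eval_mul, Polynomial.eval_X,
      eval_revChebU x hx j, eval_revChebU x hx (j + 1), chebU_add_two]
    have h : 2 * x * (2 * x)⁻¹ = 1 := mul_inv_cancel₀ (by simpa using hx)
    generalize (2 * x)⁻¹ = y at h ⊢
    linear_combination (-(y ^ (j + 1) * chebU (j + 1) x)) * h

open PowerSeries in
theorem avoidersSeries_mul_revChebU (k : ℕ) :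
    avoidersSeries k * (revChebU (k + 2) : PowerSeries ℝ) = revChebU (k + 1) := by
  induction k with
  | zero =>
    have h : (revChebU (0 + 2) : PowerSeries ℝ) = 1 - X := by
      rw [revChebU_add_two, revChebU, revChebU]
      simp
    rw [h, avoidersSeries_zero_mul, revChebU]
    simp
  | succ k ih =>
    rw [revChebU_add_two (k + 1)]
    push_cast
    have h := avoidersSeries_succ k
    linear_combination (revChebU (k + 2) : PowerSeries ℝ) * h + X * avoidersSeries (k + 1) * ih

open PowerSeries in
-- The counting recursion says that `1 - X * avoidersSeries k` is inverse to `avoidersSeries (k +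
-- 1)`, which solves the linear equation for `lisSeries (k + 1)`.
theorem lisSeries_succ_eq (k : ℕ) :
    lisSeries (k + 1) = X * (lisSeries k + 1) * avoidersSeries (k + 1) ^ 2 := by
  linear_combination avoidersSeries (k + 1) * lisSeries_succ k -
    lisSeries (k + 1) * avoidersSeries_succ k

theorem lisSeries_zero_eq : lisSeries 0 = PowerSeries.X * avoidersSeries 0 := by
  linear_combination avoidersSeries 0 * lisSeries_zero_mul - lisSeries 0 * avoidersSeries_zero_mul

theorem rescale_X_eq (r : ℝ) :
    PowerSeries.rescale r (PowerSeries.X : PowerSeries ℝ) =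
      PowerSeries.C r * PowerSeries.X := by
  ext n
  simp only [PowerSeries.coeff_rescale, PowerSeries.coeff_C_mul, PowerSeries.coeff_X]
  split_ifs with h <;> simp [h]

theorem coeff_rescale_avoidersSeries_nonneg {r : ℝ} (hr : 0 ≤ r) (k n : ℕ) :
    0 ≤ PowerSeries.coeff n (PowerSeries.rescale r (avoidersSeries k)) := by
  rw [PowerSeries.coeff_rescale, coeff_avoidersSeries]
  positivity

theorem rescale_avoidersSeries_succ (r : ℝ) (k : ℕ) :
    PowerSeries.rescale r (avoidersSeries (k + 1)) = 1 + PowerSeries.C r * PowerSeries.X *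
      (PowerSeries.rescale r (avoidersSeries k) *
        PowerSeries.rescale r (avoidersSeries (k + 1))) := by
  conv_lhs => rw [avoidersSeries_succ]
  simp only [map_add, map_mul, map_one, rescale_X_eq]

theorem rescale_avoidersSeries_zero (r : ℝ) :
    PowerSeries.rescale r (avoidersSeries 0) = 1 + PowerSeries.C r * PowerSeries.X *
      (1 * PowerSeries.rescale r (avoidersSeries 0)) := by
  have h : avoidersSeries 0 = 1 + PowerSeries.X * avoidersSeries 0 := by
    linear_combination avoidersSeries_zero_mul
  conv_lhs => rw [h]
  simp only [map_add, map_mul, map_one, rescale_X_eq, one_mul]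

/-! ### Values of the lower-level series at the critical point -/

section Subcritical

variable {m : ℕ} {c : ℝ} (hc : 0 < c) (hpos : ∀ j < m, 0 < chebU j c)
include hc hpos

/-- With `r = (2c)⁻²` and `F` the value at level `k`, the Chebyshev recursion gives `1 - r F =
U_{k+3} / (2c U_{k+2})`, so positivity of `U_{k+3}` is what lets the induction continue. -/
theorem hasAbsSum_avoidersSeries (k : ℕ) (hk : k + 2 < m) :
    HasAbsSum (PowerSeries.rescale ((2 * c)⁻¹ ^ 2) (avoidersSeries k))
      (2 * c * chebU (k + 1) c / chebU (k + 2) c) := by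
  have hr : 0 ≤ (2 * c)⁻¹ ^ 2 := by positivity
  have hnn := fun k => coeff_rescale_avoidersSeries_nonneg hr k
  induction k with
  | zero =>
    have h2 := hpos 2 (by omega)
    have e2 : chebU 2 c = 2 * c * (2 * c) - 1 := by
      rw [chebU_add_two 0, chebU_zero, zero_add, chebU_one]
    rw [e2] at h2
    have hc2 : (2 * c)⁻¹ ^ 2 * 1 < 1 := by
      rw [mul_one, inv_pow]
      exact inv_lt_one_of_one_lt₀ (by nlinarith)
    have h := HasAbsSum.of_eq_one_add HasAbsSum.one
      (fun n => by rw [PowerSeries.coeff_one]; split_ifs <;> norm_num) (hnn 0) hr hc2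
      (rescale_avoidersSeries_zero _)
    convert h using 1
    rw [zero_add, zero_add, e2, chebU_one]
    field_simp
  | succ k ih =>
    have h1 := hpos (k + 1) (by omega)
    have h2 := hpos (k + 2) (by omega)
    have h3 := hpos (k + 3) (by omega)
    have e3 : chebU (k + 3) c = 2 * c * chebU (k + 2) c - chebU (k + 1) c :=
      chebU_add_two (k + 1) c
    have hval : (2 * c)⁻¹ ^ 2 * (2 * c * chebU (k + 1) c / chebU (k + 2) c) =
        1 - chebU (k + 3) c / (2 * c * chebU (k + 2) c) := by
      rw [e3]
      field_simp
      ring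
    have hlt : (2 * c)⁻¹ ^ 2 * (2 * c * chebU (k + 1) c / chebU (k + 2) c) < 1 := by
      rw [hval]
      have : 0 < chebU (k + 3) c / (2 * c * chebU (k + 2) c) := by positivity
      linarith
    have h := HasAbsSum.of_eq_one_add (ih (by omega)) (hnn k) (hnn (k + 1)) hr hlt
      (rescale_avoidersSeries_succ _ k)
    convert h using 1
    rw [hval, sub_sub_cancel, inv_div]

/-- Writing `H_k` for the value plus one, the recursion becomes `U_{k+3}² H_{k+1} = U_{k+2}² H_k +
U_{k+3}²`, which telescopes from `U_2² H_0 = U_2 + U_2²`. -/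
theorem hasAbsSum_lisSeries (k : ℕ) (hk : k + 2 < m) :
    HasAbsSum (PowerSeries.rescale ((2 * c)⁻¹ ^ 2) (lisSeries k))
      ((chebU 2 c + ∑ j ∈ Finset.Icc 2 (k + 2), chebU j c ^ 2) / chebU (k + 2) c ^ 2 - 1) := by
  induction k with
  | zero =>
    have h2 := hpos 2 (by omega)
    rw [lisSeries_zero_eq, map_mul, rescale_X_eq]
    convert (HasAbsSum.C_mul_X _).mul (hasAbsSum_avoidersSeries hc hpos 0 hk) using 1
    simp only [zero_add, Finset.Icc_self, Finset.sum_singleton, chebU_one]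
    field_simp
    ring
  | succ k ih =>
    have h2 := hpos (k + 2) (by omega)
    have h3 := hpos (k + 3) (by omega)
    have h := ((HasAbsSum.C_mul_X ((2 * c)⁻¹ ^ 2)).mul ((ih (by omega)).add HasAbsSum.one)).mul
      ((hasAbsSum_avoidersSeries hc hpos (k + 1) hk).mul
        (hasAbsSum_avoidersSeries hc hpos (k + 1) hk))
    rw [lisSeries_succ_eq, sq (avoidersSeries (k + 1)), map_mul, map_mul, map_mul, map_add, map_one, rescale_X_eq]
    convert h using 1
    rw [show k + 1 + 2 = k + 2 + 1 from rfl, Finset.sum_Icc_succ_top (by omega),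
      show k + 1 + 1 = k + 2 from rfl, show k + 2 + 1 = k + 3 from rfl]
    field_simp
    ring

end Subcritical

/-! ### The dominant pole and the limit -/

theorem cos_pi_div_pos {m : ℕ} (hm : 2 ≤ m) : 0 < Real.cos (Real.pi / (m + 1)) := by
  have hπ := Real.pi_pos
  have hm' : (2 : ℝ) ≤ m := by exact_mod_cast hm
  refine Real.cos_pos_of_mem_Ioo ⟨?_, ?_⟩
  · have : 0 < Real.pi / (m + 1) := by positivity
    linarith
  · exact div_lt_div_of_pos_left hπ two_pos (by linarith)

theorem abs_cos_lt {m j : ℕ} (hj : 2 ≤ j) (hjm : j < m) :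
    |Real.cos (j * Real.pi / (m + 1))| < Real.cos (Real.pi / (m + 1)) := by
  have hπ := Real.pi_pos
  have hm : (0 : ℝ) < m + 1 := by positivity
  have h2 : (2 : ℝ) ≤ j := by exact_mod_cast hj
  have h3 : (j : ℝ) + 1 ≤ m := by exact_mod_cast hjm
  have h0 : 0 < Real.pi / (m + 1) := by positivity
  have e : (m + 1) * (Real.pi / (m + 1)) = Real.pi := by field_simp
  rw [mul_div_assoc]
  set θ := Real.pi / (m + 1) with hθ
  rw [abs_lt]
  constructor
  · rw [← Real.cos_pi_sub]
    exact Real.cos_lt_cos_of_nonneg_of_le_pi (by positivity) (by nlinarith) (by nlinarith)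
  · exact Real.cos_lt_cos_of_nonneg_of_le_pi h0.le (by nlinarith) (by nlinarith)

theorem eval_revChebU_eq_prod (K : ℕ) (t : ℝ) (ht : t ≠ 0) :
    ((revChebU (K + 3)).comp (Polynomial.C ((2 * Real.cos (Real.pi / ((K + 3 : ℕ) + 1)))⁻¹ ^ 2) *
      Polynomial.X)).eval (t ^ 2) = (1 - t) * (1 + t) * ∏ j ∈ Finset.Icc 2 (K + 2),
        (1 - Real.cos (j * Real.pi / ((K + 3 : ℕ) + 1)) /
          Real.cos (Real.pi / ((K + 3 : ℕ) + 1)) * t) := by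
  have hc := cos_pi_div_pos (m := K + 3) (by omega)
  set c := Real.cos (Real.pi / ((K + 3 : ℕ) + 1)) with hcdef
  -- At `x = c / t` the argument `(2x)⁻²` is `ρ t²`. The extreme roots `±c` of `U_{K+3}` produce the
  -- factors `1 - t` and `1 + t`.
  have h := eval_revChebU (c / t) (by positivity) (K + 3)
  have e1 : (2 * (c / t))⁻¹ ^ 2 = (2 * c)⁻¹ ^ 2 * t ^ 2 := by
    field_simp
  rw [e1] at h
  rw [Polynomial.eval_comp, Polynomial.eval_mul, Polynomial.eval_C, Polynomial.eval_X, h,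
    chebU_eq_prod, ← mul_assoc, ← mul_pow, show (2 * (c / t))⁻¹ * 2 = t / c by field_simp]
  have e2 : (t / c) ^ (K + 3) = ∏ _k ∈ Finset.range (K + 3), t / c := by
    rw [Finset.prod_const, Finset.card_range]
  rw [e2, ← Finset.prod_mul_distrib, Finset.prod_range_succ, Finset.prod_range_succ']
  have hfirst : Real.cos ((((0 : ℕ) : ℝ) + 1) * Real.pi / ((K + 3 : ℕ) + 1)) = c := by
    simp [hcdef]
  have hlast : Real.cos ((((K + 2 : ℕ) : ℝ) + 1) * Real.pi / ((K + 3 : ℕ) + 1)) = -c := by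
    rw [hcdef, ← Real.cos_pi_sub]
    congr 1
    push_cast
    field_simp
    ring
  have hmid : ∏ j ∈ Finset.Icc 2 (K + 2),
      (1 - Real.cos (j * Real.pi / ((K + 3 : ℕ) + 1)) / c * t) =
      ∏ k ∈ Finset.range (K + 1), t / c *
        (c / t - Real.cos ((((k + 1 : ℕ) : ℝ) + 1) * Real.pi / ((K + 3 : ℕ) + 1))) := by
    rw [← Finset.Ico_succ_right_eq_Icc, Finset.prod_Ico_eq_prod_range]
    refine Finset.prod_congr rfl fun k _ => ?_
    have : ((2 + k : ℕ) : ℝ) = ((k + 1 : ℕ) : ℝ) + 1 := by push_cast; ring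
    rw [this]
    field_simp
  rw [hfirst, hlast, ← hmid]
  generalize ∏ j ∈ Finset.Icc 2 (K + 2),
    (1 - Real.cos (j * Real.pi / ((K + 3 : ℕ) + 1)) / c * t) = P
  field_simp
  ring

theorem lisConst_pos_and_tendsto (K : ℕ) :
    0 < lisConst (K + 3) ∧ Tendsto (fun n : ℕ => expectedLIS n (hatPattern (K + 3) (by omega)) / n)
      atTop (𝓝 (lisConst (K + 3))) := by
  have hc := cos_pi_div_pos (m := K + 3) (by omega)
  have hfac := eval_revChebU_eq_prod K
  have hlt : ∀ j ∈ Finset.Icc 2 (K + 2), |Real.cos (j * Real.pi / ((K + 3 : ℕ) + 1))| <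
      Real.cos (Real.pi / ((K + 3 : ℕ) + 1)) := fun j hj =>
    abs_cos_lt (Finset.mem_Icc.1 hj).1 (by have := (Finset.mem_Icc.1 hj).2; omega)
  have hpos : ∀ j < K + 3, 0 < chebU j (Real.cos (Real.pi / ((K + 3 : ℕ) + 1))) :=
    fun j hj => chebU_cos_pos hj
  unfold lisConst
  rw [show K + 3 - 1 = K + 2 from rfl]
  set c := Real.cos (Real.pi / ((K + 3 : ℕ) + 1)) with hcdef
  set ρ := (2 * c)⁻¹ ^ 2 with hρ
  have hρpos : 0 < ρ := by positivity
  obtain ⟨S, hS, hSD⟩ := exists_absSum_inverse (Finset.Icc 2 (K + 2))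
    (fun j : ℕ => Real.cos (j * Real.pi / ((K + 3 : ℕ) + 1)) / c)
    (fun j hj => by
      rw [abs_div, abs_of_pos hc]
      exact (div_lt_one hc).2 (hlt j hj)) _ hfac
  set F := PowerSeries.rescale ρ (avoidersSeries (K + 1)) with hFdef
  set E := (revChebU (K + 2)).comp (Polynomial.C ρ * Polynomial.X) with hE
  have hF : F * (1 - PowerSeries.X) = (E : PowerSeries ℝ) * S := by
    have h1 := congrArg (PowerSeries.rescale ρ) (avoidersSeries_mul_revChebU (K + 1))
    rw [map_mul, rescale_coe_polynomial, rescale_coe_polynomial] at h1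
    linear_combination S * h1 - F * hSD
  have hES := (HasAbsSum.coe E).mul hS
  set A := E.eval 1 * (∏ j ∈ Finset.Icc 2 (K + 2),
    (1 - Real.cos (j * Real.pi / ((K + 3 : ℕ) + 1)) / c))⁻¹ with hA
  -- The double pole comes from the square of the counting series alone; the factor with `lisSeries
  -- K` is summable at `ρ`.
  have hG : PowerSeries.rescale ρ (lisSeries (K + 1)) * (1 - PowerSeries.X) ^ 2 =
      PowerSeries.C ρ * PowerSeries.X * (PowerSeries.rescale ρ (lisSeries K) + 1) *
        ((E : PowerSeries ℝ) * S * ((E : PowerSeries ℝ) * S)) := by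
    rw [lisSeries_succ_eq, ← hF, sq (avoidersSeries (K + 1)), map_mul, map_mul, map_mul, map_add,
      map_one, rescale_X_eq]
    ring
  have hlimF := tendsto_coeff_of_mul_one_sub hES hF
  have hlimG := tendsto_coeff_div_of_mul_one_sub_sq
    (((HasAbsSum.C_mul_X ρ).mul ((hasAbsSum_lisSeries hc hpos K (by omega)).add
      HasAbsSum.one)).mul (hES.mul hES)) hG
  have hu := hpos (K + 2) (by omega)
  have hu2 := hpos 2 (by omega)
  have hprod : 0 < ∏ j ∈ Finset.Icc 2 (K + 2),
      (c - Real.cos (j * Real.pi / ((K + 3 : ℕ) + 1))) :=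
    Finset.prod_pos fun j hj => by linarith [(abs_lt.1 (hlt j hj)).2]
  have hAval : A = chebU (K + 2) c / (2 ^ (K + 2) * c *
      ∏ j ∈ Finset.Icc 2 (K + 2), (c - Real.cos (j * Real.pi / ((K + 3 : ℕ) + 1)))) := by
    have h1 : ∏ j ∈ Finset.Icc 2 (K + 2),
        (1 - Real.cos (j * Real.pi / ((K + 3 : ℕ) + 1)) / c) =
        (∏ j ∈ Finset.Icc 2 (K + 2), (c - Real.cos (j * Real.pi / ((K + 3 : ℕ) + 1)))) /
          c ^ (K + 1) := by
      have h2 : c ^ (K + 1) = ∏ _j ∈ Finset.Icc 2 (K + 2), c := by simp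
      rw [h2, ← Finset.prod_div_distrib]
      refine Finset.prod_congr rfl fun j _ => ?_
      field_simp
    have h3 : E.eval 1 = (2 * c)⁻¹ ^ (K + 2) * chebU (K + 2) c := by
      rw [hE, Polynomial.eval_comp, Polynomial.eval_mul, Polynomial.eval_C, Polynomial.eval_X,
        mul_one, hρ, eval_revChebU c hc.ne']
    rw [hA, h1, h3, inv_pow, mul_pow]
    generalize ∏ j ∈ Finset.Icc 2 (K + 2),
      (c - Real.cos (j * Real.pi / ((K + 3 : ℕ) + 1))) = P at hprod ⊢
    field_simp
    ring
  have hApos : 0 < A := by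
    rw [hAval]
    positivity
  have hsum : 0 ≤ ∑ j ∈ Finset.Icc 2 (K + 2), chebU j c ^ 2 :=
    Finset.sum_nonneg fun j _ => sq_nonneg _
  refine ⟨by positivity, ?_⟩
  have hlim := hlimG.div hlimF hApos.ne'
  -- One factor `A` cancels between total length and count; the other supplies the product in
  -- `lisConst`.
  have hval : ρ * ((chebU 2 c + ∑ j ∈ Finset.Icc 2 (K + 2), chebU j c ^ 2) /
      chebU (K + 2) c ^ 2 - 1 + 1) * (A * A) / A =
      (chebU 2 c + ∑ j ∈ Finset.Icc 2 (K + 2), chebU j c ^ 2) /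
        (2 ^ (K + 3 + 1) * c ^ 3 * chebU (K + 2) c *
          ∏ j ∈ Finset.Icc 2 (K + 2), (c - Real.cos (j * Real.pi / ((K + 3 : ℕ) + 1)))) := by
    rw [sub_add_cancel, mul_div_assoc, mul_self_div_self, hAval, hρ]
    generalize ∏ j ∈ Finset.Icc 2 (K + 2),
      (c - Real.cos (j * Real.pi / ((K + 3 : ℕ) + 1))) = P at hprod ⊢
    field_simp
    ring
  rw [hval] at hlim
  refine hlim.congr fun n => ?_
  have hρn : ρ ^ n ≠ 0 := (pow_pos hρpos n).ne'
  simp only [Pi.div_apply, hFdef, PowerSeries.coeff_rescale, coeff_avoidersSeries, coeff_lisSeries]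
  change _ = expectedLIS n (hatPattern (K + 1 + 2) _) / n
  rw [expectedLIS, mul_div_assoc, mul_div_mul_left _ _ hρn, div_right_comm]

theorem theorem3p8 (m : ℕ) (hm : 4 ≤ m) :
    Tendsto
      (fun n : ℕ => expectedLIS n (hatPattern m (le_trans (by norm_num) hm)) / (lisConst m * n))
      atTop (𝓝 1) := by
  obtain ⟨K, rfl⟩ : ∃ K, m = K + 3 := ⟨m - 3, by omega⟩
  obtain ⟨hpos, h⟩ := lisConst_pos_and_tendsto K
  have h1 := h.div_const (lisConst (K + 3))
  rw [div_self hpos.ne'] at h1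
  refine h1.congr fun n => ?_
  rw [div_div, mul_comm]
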